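/- Let $H$ be a separable complex Hilbert space (in particular, $H$ may be infinite-dimensional). Let $\mathrm{SA}(H)$ be the set of all (possibly unbounded, densely defined) self-adjoint operators on $H$, equipped with the strong resolvent topology, that is, the weakest topology for which $A\mapsto (A-i)^{-1}\xi\in H$ is continuous for every $\xi\in H$. Then $\mathrm{SA}(H)$ is a Polish space, and: (1) the set $\{(A,\xi)\in \mathrm{SA}(H)\times H : \xi\in\operatorname{dom}(A)\}$ is a Borel subset of $\mathrm{SA}(H)\times H$; (2) the domain equivalence relation on $\mathrm{SA}(H)$, given by $A\sim B$ if and only if $\operatorname{dom}(A)=\operatorname{dom}(B)$, is co-analytic: the complement of $\{(A,B):\operatorname{dom}(A)=\operatorname{dom}(B)\}$ in $\mathrm{SA}(H)\times\mathrm{SA}(H)$ is an analytic set, i.e. a continuous image of a Polish space (possibly empty). -/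

import Mathlib

open scoped ComplexInnerProductSpace MeasureTheory

/-- The set of all (possibly unbounded, necessarily densely defined) self-adjoint operators on
the complex Hilbert space `H`. -/
def SA (H : Type*) [NormedAddCommGroup H] [InnerProductSpace ℂ H] [CompleteSpace H] : Type _ :=
  {A : H →ₗ.[ℂ] H // IsSelfAdjoint A}

namespace SA

variable {H : Type*} [NormedAddCommGroup H] [InnerProductSpace ℂ H] [CompleteSpace H]

/-- The domain of a self-adjoint operator. -/
abbrev dom (A : SA H) : Submodule ℂ H := A.1.domain

/-- The linear map `A - i : dom A → H`. -/
noncomputable def subI (A : SA H) : A.dom →ₗ[ℂ] H :=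
  A.1.toFun - Complex.I • A.dom.subtype

theorem subI_apply (A : SA H) (x : A.dom) :
    A.subI x = A.1 x - Complex.I • (x : H) := rfl

theorem inner_symm (A : SA H) (x y : A.dom) : ⟪A.1 x, (y : H)⟫ = ⟪(x : H), A.1 y⟫ := by
  have h := LinearPMap.adjoint_isFormalAdjoint A.2.dense_domain
  rw [LinearPMap.isSelfAdjoint_def.1 A.2] at h
  exact h x y

theorem inner_self_im (A : SA H) (x : A.dom) : (⟪A.1 x, (x : H)⟫).im = 0 := by
  rw [← Complex.conj_eq_iff_im, inner_conj_symm, A.inner_symm]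

theorem norm_sq_subI (A : SA H) (x : A.dom) :
    ‖A.subI x‖ ^ 2 = ‖A.1 x‖ ^ 2 + ‖(x : H)‖ ^ 2 := by
  have h := A.inner_self_im x
  rw [subI_apply, norm_sub_sq (𝕜 := ℂ), inner_smul_right, norm_smul]
  simp [h]

theorem subI_injective (A : SA H) : Function.Injective A.subI := by
  rw [injective_iff_map_eq_zero]
  intro x hx
  have h := A.norm_sq_subI x
  rw [hx, norm_zero] at h
  have : ‖(x : H)‖ = 0 := by nlinarith [sq_nonneg ‖A.1 x‖, norm_nonneg (x : H)]
  exact Subtype.ext (norm_eq_zero.1 this)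

theorem isClosed_range_subI (A : SA H) : IsClosed (LinearMap.range A.subI : Set H) := by
  have hcl : IsClosed (A.1.graph : Set (H × H)) := A.2.isClosed
  have : CompleteSpace A.1.graph := hcl.completeSpace_coe
  let f : A.1.graph →L[ℂ] H :=
    (ContinuousLinearMap.snd ℂ H H - Complex.I • ContinuousLinearMap.fst ℂ H H).comp
      A.1.graph.subtypeL
  have hanti : AntilipschitzWith 1 f := by
    refine AddMonoidHomClass.antilipschitz_of_bound f fun p => ?_
    obtain ⟨⟨a, b⟩, hp⟩ := p
    obtain ⟨x, hx, hb⟩ := (LinearPMap.mem_graph_iff A.1).1 hp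
    have h := A.norm_sq_subI x
    rw [subI_apply] at h
    have hf : f ⟨(a, b), hp⟩ = b - Complex.I • a := rfl
    simp only at hx hb
    rw [hx, hb] at h
    rw [hf, NNReal.coe_one, one_mul]
    change max ‖a‖ ‖b‖ ≤ _
    refine max_le ?_ ?_ <;> refine le_of_sq_le_sq ?_ (norm_nonneg _) <;> rw [h] <;> nlinarith
  have hr := hanti.isClosed_range f.uniformContinuous
  convert hr using 1
  ext y
  constructor
  · rintro ⟨x, rfl⟩
    exact ⟨⟨(x, A.1 x), A.1.mem_graph x⟩, rfl⟩
  · rintro ⟨⟨⟨a, b⟩, hp⟩, rfl⟩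
    obtain ⟨x, hx, hb⟩ := (LinearPMap.mem_graph_iff A.1).1 hp
    simp only at hx hb
    subst hx hb
    exact ⟨x, rfl⟩

theorem subI_surjective (A : SA H) : Function.Surjective A.subI := by
  have hcl := A.isClosed_range_subI
  have : CompleteSpace (LinearMap.range A.subI) := hcl.completeSpace_coe
  rw [← LinearMap.range_eq_top, ← Submodule.orthogonal_eq_bot_iff, Submodule.eq_bot_iff]
  intro y hy
  have hy' : ∀ x : A.1.domain, ⟪Complex.I • y, (x : H)⟫ = - ⟪y, A.1 x⟫ := by
    intro x
    have h := (Submodule.mem_orthogonal' _ _).1 hy (A.subI x) ⟨x, rfl⟩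
    rw [subI_apply, inner_sub_right, inner_smul_right] at h
    rw [inner_smul_left, Complex.conj_I]
    linear_combination h
  have hw : ∀ x : A.1.domain, ⟪-(Complex.I • y), (x : H)⟫ = ⟪y, A.1 x⟫ := by
    intro x
    rw [inner_neg_left, hy', neg_neg]
  have hsa := LinearPMap.isSelfAdjoint_def.1 A.2
  have hyd : y ∈ A.1.adjoint.domain := LinearPMap.mem_adjoint_domain_of_exists y ⟨_, hw⟩
  rw [hsa] at hyd
  have h1 := hw ⟨y, hyd⟩
  have h2 := A.inner_self_im ⟨y, hyd⟩
  rw [A.inner_symm, ← h1, inner_neg_left, inner_smul_left, Complex.conj_I,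
    inner_self_eq_norm_sq_to_K] at h2
  have h3 : ‖y‖ ^ 2 = 0 := by simpa [← Complex.ofReal_pow] using h2
  exact norm_eq_zero.1 (pow_eq_zero_iff two_ne_zero |>.1 h3)

/-- The resolvent `(A - i)⁻¹ : H → dom A ⊆ H`, the inverse of the bijection
`A - i : dom A → H`. -/
noncomputable def resolvent (A : SA H) (ξ : H) : H :=
  ((LinearEquiv.ofBijective A.subI ⟨A.subI_injective, A.subI_surjective⟩).symm ξ : A.dom)

/-- The strong resolvent topology: the weakest topology on `SA H` for which
`A ↦ (A - i)⁻¹ ξ` is continuous for every `ξ : H`. -/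
noncomputable instance instTopologicalSpace : TopologicalSpace (SA H) :=
  ⨅ ξ : H, TopologicalSpace.induced (fun A : SA H => A.resolvent ξ) inferInstance

/-- The domain equivalence relation: `A` and `B` are equivalent iff `dom A = dom B`. -/
def domEquiv (H : Type*) [NormedAddCommGroup H] [InnerProductSpace ℂ H] [CompleteSpace H] :
    Setoid (SA H) where
  r A B := A.dom = B.dom
  iseqv := ⟨fun _ => rfl, fun h => h.symm, fun h h' => h.trans h'⟩

end SA

/-- A set is co-analytic if its complement is analytic. -/
def IsCoanalytic {X : Type*} [TopologicalSpace X] (s : Set X) : Prop :=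
  MeasureTheory.AnalyticSet sᶜ

/-- An equivalence relation on `X` is co-analytic if it is a co-analytic subset of `X × X`. -/
def Setoid.IsCoanalytic {X : Type*} [TopologicalSpace X] (E : Setoid X) : Prop :=
  _root_.IsCoanalytic {p : X × X | E p.1 p.2}

/-!
A self-adjoint operator `A` is encoded by its Cayley transform `U = (A + i)(A - i)⁻¹ = 1 + 2iR`,
where `R = (A - i)⁻¹`. The map `A ↦ U` is a bijection from `SA H` onto the unitary operators for
which `U - 1` has dense range (`SA.cayley_surjective`, `SA.denseRange_cayley_sub_self`,
`SA.exists_cayley_eq`), and it turns the strong resolvent topology into the topology of pointwise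
convergence.

Fix a countable dense set `D ⊆ H`. As all the maps `U` are isometries, pointwise convergence on
`H` is pointwise convergence on `D`, so that `A ↦ U|_D` embeds `SA H` into the Polish space
`D → H`. By `SA.range_cayley_domRestrict` its range consists of the `u : D → H` which preserve
inner products (a closed condition), have dense range (so that the isometric extension of `u` to
`H` is onto), and for which `x ↦ u x - x` has dense range. The last two conditions are `Gδ` because
`H` is second countable, and a `Gδ` subset of a Polish space is Polish.

The domain of `A` is the range of the injective map `R`. Hence `{(A, ξ) | ξ ∈ dom A}` is the range
of the continuous injection `(A, η) ↦ (A, R η)` of the Polish space `SA H × H` into itself, which is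
Borel by the Lusin–Souslin theorem. Finally `dom A ≠ dom B` holds iff some `ξ` lies in exactly one
of the two domains, so the complement of the domain equivalence relation is the projection of a
Borel set, and therefore analytic.
-/

open Topology Set

/-! ### Dense ranges and `Gδ` sets in Polish spaces -/

/-- A `Gδ` subset `⋂ n, V n` of a Polish space is Polish: it is homeomorphic, via the diagonal, to a
closed subset of the product of the open (hence Polish) subspaces `V n`. -/
theorem IsGδ.polishSpace {X : Type*} [TopologicalSpace X] [PolishSpace X] {s : Set X}
    (hs : IsGδ s) : PolishSpace s := by
  obtain ⟨V, hV, rfl⟩ := isGδ_iff_eq_iInter_nat.1 hs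
  have := fun n => (hV n).polishSpace
  let φ : (⋂ n, V n : Set X) → ∀ n, V n := fun x n => ⟨x, mem_iInter.1 x.2 n⟩
  have hφ : Continuous φ := by fun_prop
  have hrange : range φ = {g | ∀ n, (g n : X) = g 0} := by
    ext g
    constructor
    · rintro ⟨x, rfl⟩ n
      rfl
    · intro hg
      exact ⟨⟨g 0, mem_iInter.2 fun n => hg n ▸ (g n).2⟩, funext fun n => Subtype.ext (hg n).symm⟩
  have hemb : IsEmbedding φ :=
    .of_comp (g := fun g => (g 0 : X)) hφ (by fun_prop) IsEmbedding.subtypeVal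
  refine IsClosedEmbedding.polishSpace (f := φ) ⟨hemb, ?_⟩
  rw [hrange, ofPred_forall]
  exact isClosed_iInter fun n => isClosed_eq (by fun_prop) (by fun_prop)

/-- Density of the range is a `Gδ` condition: for each of countably many basic open sets `o`, some
`F x i` lies in `o`, which is open in `x`. -/
theorem isGδ_setOf_denseRange_apply {X Y ι : Type*} [TopologicalSpace X] [TopologicalSpace Y]
    [SecondCountableTopology Y] {F : X → ι → Y} (hF : ∀ i, Continuous fun x => F x i) :
    IsGδ {x | DenseRange (F x)} := by
  have h : {x | DenseRange (F x)} = ⋂ o ∈ {o ∈ TopologicalSpace.countableBasis Y | o.Nonempty},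
      ⋃ i, (fun x => F x i) ⁻¹' o := by
    ext x
    simp only [mem_ofPred_eq, DenseRange,
      (TopologicalSpace.isBasis_countableBasis Y).dense_iff, mem_iInter, mem_iUnion, mem_preimage,
      and_imp]
    refine forall₃_congr fun o _ _ => ?_
    exact ⟨fun ⟨_, hy, i, hi⟩ => ⟨i, hi ▸ hy⟩, fun ⟨i, hi⟩ => ⟨_, hi, i, rfl⟩⟩
  rw [h]
  refine .biInter ((TopologicalSpace.countable_countableBasis Y).mono fun _ ho => ho.1)
    fun o ho => (isOpen_iUnion fun i => ?_).isGδ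
  exact (TopologicalSpace.isOpen_of_mem_countableBasis ho.1).preimage (hF i)

/-! ### Unitary operators from inner-product-preserving maps -/

section Isometry

variable {H : Type*} [NormedAddCommGroup H] [InnerProductSpace ℂ H]

/-- A map preserving inner products is linear: the squared norm of the defect
`f (c • x + y) - (c • f x + f y)` expands to that of `(c • x + y) - (c • x + y)`. -/
theorem map_add_smul_of_inner_map_map {f : H → H} (hf : ∀ x y, ⟪f x, f y⟫ = ⟪x, y⟫)
    (c : ℂ) (x y : H) : f (c • x + y) = c • f x + f y := by
  rw [← sub_eq_zero, ← inner_self_eq_zero (𝕜 := ℂ)]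
  simp only [inner_sub_left, inner_sub_right, inner_add_left, inner_add_right, inner_smul_left,
    inner_smul_right, hf]
  ring

/-- An inner-product-preserving map with dense range, defined on a dense set, extends to a unitary
operator. The set need not be a subspace, as linearity comes for free. -/
theorem Dense.exists_linearIsometryEquiv_of_inner [CompleteSpace H] {D : Set H} (hD : Dense D)
    {u : D → H} (hu : ∀ x y, ⟪u x, u y⟫ = ⟪(x : H), (y : H)⟫) (hr : DenseRange u) :
    ∃ U : H ≃ₗᵢ[ℂ] H, ∀ x : D, U x = u x := by
  have hdist : Isometry u := by
    refine Isometry.of_dist_eq fun x y => ?_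
    rw [Subtype.dist_eq, dist_eq_norm, dist_eq_norm, ← sq_eq_sq₀ (norm_nonneg _) (norm_nonneg _),
      ← Complex.ofReal_inj]
    push_cast
    have h := fun z : H => (inner_self_eq_norm_sq_to_K (𝕜 := ℂ) z).symm
    simp only [RCLike.ofReal_eq_complex_ofReal] at h
    simp only [h, inner_sub_left, inner_sub_right, hu]
  have huc := hdist.uniformContinuous
  set f : H → H := hD.extend u
  have hf : Continuous f := (hD.uniformContinuous_extend huc).continuous
  have hfu : ∀ x : D, f x = u x := hD.extend_of_ind huc
  have hinner : ∀ x y, ⟪f x, f y⟫ = ⟪x, y⟫ := by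
    refine fun x y => DenseRange.induction_on₂ (e := ((↑) : D → H))
      (p := fun x y => ⟪f x, f y⟫ = ⟪x, y⟫) hD.denseRange_val ?_ ?_ x y
    · exact isClosed_eq (by fun_prop) (by fun_prop)
    · intro x y
      rw [hfu, hfu, hu]
  have hlin := map_add_smul_of_inner_map_map hinner
  have hzero : f 0 = 0 := by simpa using hlin (-1) 0 0
  let L : H →ₗ[ℂ] H :=
    { toFun := f
      map_add' := fun x y => by simpa using hlin 1 x y
      map_smul' := fun c x => by simpa [hzero] using hlin c x 0 }
  let V : H →ₗᵢ[ℂ] H := L.isometryOfInner hinner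
  have hsurj : Function.Surjective V := by
    have hd : DenseRange V := hr.mono <| by
      rintro _ ⟨x, rfl⟩
      exact ⟨x, hfu x⟩
    rw [← range_eq_univ, ← V.isometry.isClosedEmbedding.isClosed_range.closure_eq, hd.closure_range]
  exact ⟨LinearIsometryEquiv.ofSurjective V hsurj, hfu⟩

end Isometry

namespace SA

variable {H : Type*} [NormedAddCommGroup H] [InnerProductSpace ℂ H] [CompleteSpace H]

/-! ### The resolvent -/

/-- The resolvent `(A - i)⁻¹` as a linear map `H → H`. -/
noncomputable def resolventLM (A : SA H) : H →ₗ[ℂ] H :=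
  A.dom.subtype ∘ₗ
    (LinearEquiv.ofBijective A.subI ⟨A.subI_injective, A.subI_surjective⟩).symm.toLinearMap

theorem resolventLM_apply (A : SA H) (ξ : H) : A.resolventLM ξ = A.resolvent ξ := rfl

theorem resolvent_mem_dom (A : SA H) (ξ : H) : A.resolvent ξ ∈ A.dom := Subtype.prop _

theorem apply_resolvent (A : SA H) (ξ : H) :
    A.1 ⟨A.resolvent ξ, A.resolvent_mem_dom ξ⟩ = ξ + Complex.I • A.resolvent ξ := by
  have h : A.subI ⟨A.resolvent ξ, A.resolvent_mem_dom ξ⟩ = ξ :=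
    (LinearEquiv.ofBijective A.subI ⟨A.subI_injective, A.subI_surjective⟩).apply_symm_apply ξ
  rw [subI_apply] at h
  exact sub_eq_iff_eq_add.1 h

theorem resolvent_subI (A : SA H) (x : A.dom) : A.resolvent (A.subI x) = x :=
  congrArg Subtype.val <|
    (LinearEquiv.ofBijective A.subI ⟨A.subI_injective, A.subI_surjective⟩).symm_apply_apply x

theorem range_resolvent (A : SA H) : range A.resolvent = A.dom :=
  Subset.antisymm (range_subset_iff.2 A.resolvent_mem_dom)
    fun x hx => ⟨_, A.resolvent_subI ⟨x, hx⟩⟩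

theorem resolvent_injective (A : SA H) : Function.Injective A.resolvent :=
  Subtype.val_injective.comp (LinearEquiv.injective _)

theorem norm_resolvent_sub_le (A : SA H) (ξ η : H) :
    ‖A.resolvent ξ - A.resolvent η‖ ≤ ‖ξ - η‖ := by
  have h := A.norm_sq_subI ⟨A.resolvent (ξ - η), A.resolvent_mem_dom _⟩
  rw [subI_apply, apply_resolvent, add_sub_cancel_right] at h
  rw [← resolventLM_apply, ← resolventLM_apply, ← map_sub, resolventLM_apply]
  refine le_of_sq_le_sq ?_ (norm_nonneg _)
  rw [h]
  exact le_add_of_nonneg_left (sq_nonneg _)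

theorem resolvent_determines {A B : SA H} (h : A.resolvent = B.resolvent) : A = B := by
  have key : ∀ {A B : SA H}, A.resolvent = B.resolvent → A.1 ≤ B.1 := by
    intro A B h
    refine LinearPMap.le_of_le_graph fun p hp => ?_
    obtain ⟨x, hx, hy⟩ := (LinearPMap.mem_graph_iff A.1).1 hp
    obtain ⟨ξ, hξ⟩ : ∃ ξ, A.resolvent ξ = x := ⟨_, A.resolvent_subI x⟩
    have hA := A.apply_resolvent ξ
    have hB := B.apply_resolvent ξ
    rw [show (⟨A.resolvent ξ, A.resolvent_mem_dom ξ⟩ : A.dom) = x from Subtype.ext hξ] at hA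
    refine (LinearPMap.mem_graph_iff B.1).2 ⟨⟨B.resolvent ξ, B.resolvent_mem_dom ξ⟩, ?_, ?_⟩
    · rw [← hx, ← hξ, h]
    · rw [hB, ← hy, hA, h]
  exact Subtype.ext (le_antisymm (key h) (key h.symm))

/-- The identity `R - R* = 2i R* R` for `R = (A - i)⁻¹`, in weak form. It is equivalent to `1 + 2iR`
being isometric. -/
theorem inner_resolvent_sub (A : SA H) (ξ η : H) :
    ⟪ξ, A.resolvent η⟫ - ⟪A.resolvent ξ, η⟫ = 2 * Complex.I * ⟪A.resolvent ξ, A.resolvent η⟫ := by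
  have h := A.inner_symm ⟨_, A.resolvent_mem_dom ξ⟩ ⟨_, A.resolvent_mem_dom η⟩
  simp only [apply_resolvent, inner_add_left, inner_add_right, inner_smul_left, inner_smul_right,
    Complex.conj_I] at h
  linear_combination h

/-! ### The Cayley transform -/

/-- The Cayley transform `(A + i)(A - i)⁻¹ = 1 + 2i (A - i)⁻¹`, as a linear isometry. That it is
onto is `SA.cayley_surjective`. -/
noncomputable def cayley (A : SA H) : H →ₗᵢ[ℂ] H :=
  (LinearMap.id + (2 * Complex.I) • A.resolventLM).isometryOfInner fun ξ η => by
    have h := A.inner_resolvent_sub ξ η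
    simp only [LinearMap.add_apply, LinearMap.id_apply, LinearMap.smul_apply, resolventLM_apply,
      inner_add_left, inner_add_right, inner_smul_left, inner_smul_right, map_mul,
      Complex.conj_I, Complex.conj_ofNat]
    linear_combination 2 * Complex.I * h

theorem cayley_apply (A : SA H) (ξ : H) :
    A.cayley ξ = ξ + (2 * Complex.I) • A.resolvent ξ := rfl

theorem cayley_sub_self (A : SA H) (ξ : H) :
    A.cayley ξ - ξ = (2 * Complex.I) • A.resolvent ξ := by
  rw [cayley_apply, add_sub_cancel_left]

theorem cayley_subI (A : SA H) (x : A.dom) :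
    A.cayley (A.subI x) = A.1 x + Complex.I • (x : H) := by
  rw [cayley_apply, resolvent_subI, subI_apply, mul_smul, two_smul]
  abel

theorem resolvent_eq_smul_cayley_sub (A : SA H) (ξ : H) :
    A.resolvent ξ = (2 * Complex.I)⁻¹ • (A.cayley ξ - ξ) := by
  rw [cayley_sub_self, inv_smul_smul₀ (by simp)]

/-- A vector `y` orthogonal to the range of the Cayley transform is orthogonal to `(A + i) x` for all
`x ∈ dom A`, so `y ∈ dom A* = dom A` and `A y = i y`, which forces `y = 0`. -/
theorem cayley_surjective (A : SA H) : Function.Surjective A.cayley := by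
  have hcl : IsClosed (LinearMap.range A.cayley.toLinearMap : Set H) :=
    A.cayley.isometry.isClosedEmbedding.isClosed_range
  have : CompleteSpace (LinearMap.range A.cayley.toLinearMap) := hcl.completeSpace_coe
  change Function.Surjective A.cayley.toLinearMap
  rw [← LinearMap.range_eq_top, ← Submodule.orthogonal_eq_bot_iff, Submodule.eq_bot_iff]
  intro y hy
  have hw : ∀ x : A.1.domain, ⟪Complex.I • y, (x : H)⟫ = ⟪y, A.1 x⟫ := by
    intro x
    have h := (Submodule.mem_orthogonal' _ _).1 hy (A.cayley (A.subI x)) ⟨_, rfl⟩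
    rw [cayley_subI, inner_add_right, inner_smul_right] at h
    rw [inner_smul_left, Complex.conj_I]
    linear_combination -h
  have hyd : y ∈ A.1.adjoint.domain := LinearPMap.mem_adjoint_domain_of_exists y ⟨_, hw⟩
  rw [LinearPMap.isSelfAdjoint_def.1 A.2] at hyd
  have h1 := hw ⟨y, hyd⟩
  have h2 := A.inner_self_im ⟨y, hyd⟩
  rw [A.inner_symm, ← h1, inner_smul_left, Complex.conj_I, inner_self_eq_norm_sq_to_K] at h2
  have h3 : ‖y‖ ^ 2 = 0 := by simpa [← Complex.ofReal_pow] using h2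
  exact norm_eq_zero.1 (pow_eq_zero_iff two_ne_zero |>.1 h3)

theorem denseRange_cayley_sub_self (A : SA H) : DenseRange fun ξ => A.cayley ξ - ξ := by
  have h : DenseRange A.resolvent := by
    rw [DenseRange, range_resolvent]
    exact A.2.dense_domain
  have h2 : Function.Surjective fun x : H => (2 * Complex.I) • x :=
    fun x => ⟨(2 * Complex.I)⁻¹ • x, smul_inv_smul₀ (by simp) x⟩
  simpa only [cayley_sub_self, Function.comp_def] using
    h2.denseRange.comp h (continuous_const_smul _)

theorem cayley_injective : Function.Injective (cayley : SA H → H →ₗᵢ[ℂ] H) := fun A B h =>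
  resolvent_determines <| funext fun ξ => by
    rw [resolvent_eq_smul_cayley_sub, resolvent_eq_smul_cayley_sub, h]

/-- Every unitary `U` such that `U - 1` has dense range is a Cayley transform. -/
theorem exists_cayley_eq (U : H ≃ₗᵢ[ℂ] H) (hU : DenseRange fun ξ => U ξ - ξ) :
    ∃ A : SA H, A.cayley = U.toLinearIsometry := by
  let R : H →ₗ[ℂ] H := (2 * Complex.I)⁻¹ • (U.toLinearEquiv.toLinearMap - LinearMap.id)
  have hUR : ∀ ξ, U ξ = ξ + (2 * Complex.I) • R ξ := by
    intro ξ
    change _ = ξ + (2 * Complex.I) • ((2 * Complex.I)⁻¹ • (U ξ - ξ))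
    rw [smul_inv_smul₀ (by simp), add_sub_cancel]
  -- A fixed vector of the unitary `U` is orthogonal to the range of `U - 1`, which is dense.
  have hinj : Function.Injective R := by
    rw [injective_iff_map_eq_zero]
    intro ξ hξ
    have hfix : U ξ = ξ := by rw [hUR, hξ, smul_zero, add_zero]
    refine hU.eq_zero_of_inner_left ℂ fun η => ?_
    have h := U.inner_map_map ξ η
    rw [hfix] at h
    rw [inner_sub_right, h, sub_self]
  have hR : ∀ ξ η, ⟪ξ, R η⟫ - ⟪R ξ, η⟫ = 2 * Complex.I * ⟪R ξ, R η⟫ := by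
    intro ξ η
    have h := U.inner_map_map ξ η
    simp only [hUR, inner_add_left, inner_add_right, inner_smul_left, inner_smul_right, map_mul,
      Complex.conj_I, Complex.conj_ofNat] at h
    linear_combination (-Complex.I / 2) * h +
      (⟪ξ, R η⟫ - ⟪R ξ, η⟫ - 2 * Complex.I * ⟪R ξ, R η⟫) * Complex.I_sq
  let e := LinearEquiv.ofInjective R hinj
  -- `T = R⁻¹ + i` on the range of `R`.
  let T : H →ₗ.[ℂ] H :=
    { domain := LinearMap.range R
      toFun := e.symm.toLinearMap + Complex.I • (LinearMap.range R).subtype }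
  have hT : ∀ ξ, T (e ξ) = ξ + Complex.I • R ξ := by
    intro ξ
    change e.symm (e ξ) + Complex.I • R ξ = _
    rw [e.symm_apply_apply]
  have hdense : Dense (T.domain : Set H) := by
    have h2 : Function.Surjective fun x : H => (2 * Complex.I)⁻¹ • x :=
      fun x => ⟨(2 * Complex.I) • x, inv_smul_smul₀ (by simp) x⟩
    exact h2.denseRange.comp hU (continuous_const_smul _)
  have hsymm : T.IsFormalAdjoint T := by
    intro x y
    obtain ⟨ξ, rfl⟩ := e.surjective x
    obtain ⟨η, rfl⟩ := e.surjective y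
    have h := hR ξ η
    change ⟪T (e ξ), R η⟫ = ⟪R ξ, T (e η)⟫
    simp only [hT, inner_add_left, inner_add_right, inner_smul_left, inner_smul_right,
      Complex.conj_I]
    linear_combination h
  have hle : T ≤ T.adjoint := hsymm.le_adjoint hdense
  have hdom : T.adjoint.domain ≤ T.domain := by
    intro y hy
    -- The inner products of `y` and `R ξ` agree against every `U η = (T + i) R η`, where
    -- `ξ = (T* - i) y` is the only possible preimage of `y` under `R = (T - i)⁻¹`.
    set z := T.adjoint ⟨y, hy⟩
    set ξ := z - Complex.I • y
    have hy : y = R ξ := by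
      refine ext_inner_right ℂ fun v => ?_
      obtain ⟨η, rfl⟩ := U.surjective v
      have h1 : ⟪z, R η⟫ = ⟪y, η + Complex.I • R η⟫ := by
        rw [← hT]
        exact LinearPMap.adjoint_isFormalAdjoint hdense ⟨y, hy⟩ (e η)
      have h2 := hR ξ η
      have h3 : ⟪ξ, R η⟫ = ⟪z, R η⟫ + Complex.I * ⟪y, R η⟫ := by
        rw [inner_sub_left, inner_smul_left, Complex.conj_I]
        ring
      rw [inner_add_right, inner_smul_right] at h1
      rw [hUR, inner_add_right, inner_add_right, inner_smul_right, inner_smul_right]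
      linear_combination h2 - h3 - h1
    exact ⟨ξ, hy.symm⟩
  have hsa : IsSelfAdjoint T :=
    (LinearPMap.eq_of_le_of_domain_eq hle (le_antisymm hle.1 hdom)).symm
  let A : SA H := ⟨T, hsa⟩
  refine ⟨A, LinearIsometry.ext fun ξ => ?_⟩
  have h : A.subI (e ξ) = ξ := by
    rw [subI_apply]
    change T (e ξ) - Complex.I • R ξ = ξ
    rw [hT, add_sub_cancel_right]
  have h' : A.resolvent ξ = R ξ := by
    conv_lhs => rw [← h]
    exact A.resolvent_subI _
  rw [cayley_apply, h']
  exact (hUR ξ).symm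

/-! ### The strong resolvent topology -/

theorem continuous_iff {X : Type*} [TopologicalSpace X] {f : X → SA H} :
    Continuous f ↔ ∀ ξ, Continuous fun x => (f x).resolvent ξ := by
  simp only [continuous_iInf_rng, continuous_induced_rng]
  rfl

theorem continuous_resolvent (ξ : H) : Continuous fun A : SA H => A.resolvent ξ :=
  continuous_iff.1 continuous_id ξ

theorem continuous_cayley (ξ : H) : Continuous fun A : SA H => A.cayley ξ := by
  simp only [cayley_apply]
  exact continuous_const.add ((continuous_resolvent ξ).const_smul _)

theorem continuous_resolvent_uncurry : Continuous fun p : SA H × H => p.1.resolvent p.2 := by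
  refine continuous_prod_of_continuous_lipschitzWith' _ 1 (fun A => ?_) continuous_resolvent
  exact LipschitzWith.of_dist_le_mul fun ξ η => by
    simpa [dist_eq_norm] using A.norm_resolvent_sub_le ξ η

/-- The strong resolvent topology is already determined by the Cayley transforms on a dense set,
because all resolvents are contractions. -/
theorem isInducing_cayley_domRestrict {D : Set H} (hD : Dense D) :
    IsInducing fun (A : SA H) (x : D) => A.cayley x := by
  refine ⟨le_antisymm ?_ ?_⟩
  · exact continuous_iff_le_induced.1 (continuous_pi fun x => continuous_cayley _)
  · let t : TopologicalSpace (SA H) :=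
      TopologicalSpace.induced (fun (A : SA H) (x : D) => A.cayley x) inferInstance
    have ht : ∀ x : D, Continuous[t, _] fun A : SA H => A.resolvent x := by
      intro x
      simp only [resolvent_eq_smul_cayley_sub]
      have h : Continuous[t, _] fun A : SA H => A.cayley x :=
        (continuous_apply x).comp
          (continuous_induced_dom (f := fun (A : SA H) (x : D) => A.cayley x))
      exact (h.sub continuous_const).const_smul _
    refine continuous_id_iff_le.1 (continuous_iff.2 fun ξ => ?_)
    refine continuous_of_uniform_approx_of_continuous fun u hu => ?_
    obtain ⟨ε, hε, hu⟩ := Metric.mem_uniformity_dist.1 hu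
    obtain ⟨x, hx, hxξ⟩ := hD.exists_dist_lt ξ hε
    refine ⟨_, ht ⟨x, hx⟩, fun A => hu ?_⟩
    rw [dist_eq_norm] at hxξ ⊢
    exact (A.norm_resolvent_sub_le ξ x).trans_lt hxξ

theorem isEmbedding_cayley_domRestrict {D : Set H} (hD : Dense D) :
    IsEmbedding fun (A : SA H) (x : D) => A.cayley x := by
  refine ⟨isInducing_cayley_domRestrict hD, fun A B h => cayley_injective ?_⟩
  refine DFunLike.coe_injective <|
    A.cayley.continuous.ext_on hD B.cayley.continuous fun x hx => congrFun h ⟨x, hx⟩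

theorem range_cayley_domRestrict {D : Set H} (hD : Dense D) :
    range (fun (A : SA H) (x : D) => A.cayley x) =
      {u : D → H | ∀ x y, ⟪u x, u y⟫ = ⟪(x : H), (y : H)⟫} ∩
        ({u | DenseRange u} ∩ {u | DenseRange fun x : D => u x - x}) := by
  ext u
  constructor
  · rintro ⟨A, rfl⟩
    refine ⟨fun x y => A.cayley.inner_map_map _ _, ?_, ?_⟩
    · exact A.cayley_surjective.denseRange.comp hD.denseRange_val A.cayley.continuous
    · exact A.denseRange_cayley_sub_self.comp hD.denseRange_val
        (A.cayley.continuous.sub continuous_id)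
  · rintro ⟨hinner, hdense, hsub⟩
    obtain ⟨U, hU⟩ := hD.exists_linearIsometryEquiv_of_inner hinner hdense
    obtain ⟨A, hA⟩ := exists_cayley_eq U <| Dense.mono (s₁ := range fun x : D => u x - x) (by
      rintro _ ⟨x, rfl⟩
      exact ⟨x, by simp only [hU]⟩) hsub
    refine ⟨A, funext fun x => ?_⟩
    rw [← hU]
    exact DFunLike.congr_fun hA (x : H)

instance polishSpace [TopologicalSpace.SeparableSpace H] : PolishSpace (SA H) := by
  obtain ⟨D, hDc, hD⟩ := TopologicalSpace.exists_countable_dense H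
  have := hDc.to_subtype
  have hemb := isEmbedding_cayley_domRestrict hD
  have hGδ : IsGδ (range fun (A : SA H) (x : D) => A.cayley x) := by
    rw [range_cayley_domRestrict hD]
    refine IsGδ.inter (IsClosed.isGδ ?_) (.inter ?_ ?_)
    · simp only [ofPred_forall]
      exact isClosed_iInter fun x => isClosed_iInter fun y =>
        isClosed_eq (by fun_prop) continuous_const
    · exact isGδ_setOf_denseRange_apply continuous_apply
    · exact isGδ_setOf_denseRange_apply fun x => (continuous_apply x).sub continuous_const
  have := hGδ.polishSpace
  exact hemb.toHomeomorph.isClosedEmbedding.polishSpace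

/-! ### Domains -/

/-- The set is the range of the continuous injection `(A, η) ↦ (A, (A - i)⁻¹ η)`. -/
theorem measurableSet_mem_dom [TopologicalSpace.SeparableSpace H] :
    MeasurableSet[borel (SA H × H)] {p : SA H × H | p.2 ∈ p.1.dom} := by
  borelize (SA H × H)
  have h : {p : SA H × H | p.2 ∈ p.1.dom} = range fun p : SA H × H => (p.1, p.1.resolvent p.2) := by
    ext ⟨A, ξ⟩
    rw [mem_ofPred_eq, ← SetLike.mem_coe, ← range_resolvent]
    simp
  rw [h]
  refine MeasureTheory.measurableSet_range_of_continuous_injective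
    (continuous_fst.prodMk continuous_resolvent_uncurry) ?_
  rintro ⟨A, ξ⟩ ⟨B, η⟩ h
  obtain ⟨rfl, h⟩ : A = B ∧ A.resolvent ξ = B.resolvent η := Prod.mk.inj h
  rw [A.resolvent_injective h]

theorem isCoanalytic_domEquiv [TopologicalSpace.SeparableSpace H] :
    (domEquiv H).IsCoanalytic := by
  borelize (SA H × H) ((SA H × SA H) × H)
  have hdom : MeasurableSet {p : SA H × H | p.2 ∈ p.1.dom} := measurableSet_mem_dom
  have h1 : MeasurableSet {q : (SA H × SA H) × H | q.2 ∈ q.1.1.dom} :=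
    hdom.preimage (f := fun q : (SA H × SA H) × H => (q.1.1, q.2))
      (by fun_prop : Continuous _).measurable
  have h2 : MeasurableSet {q : (SA H × SA H) × H | q.2 ∈ q.1.2.dom} :=
    hdom.preimage (f := fun q : (SA H × SA H) × H => (q.1.2, q.2))
      (by fun_prop : Continuous _).measurable
  have h : {p : SA H × SA H | domEquiv H p.1 p.2}ᶜ = Prod.fst '' symmDiff
      {q : (SA H × SA H) × H | q.2 ∈ q.1.1.dom} {q : (SA H × SA H) × H | q.2 ∈ q.1.2.dom} := by
    ext ⟨A, B⟩
    change ¬ (A.dom = B.dom) ↔ _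
    rw [SetLike.ext_iff, not_forall]
    simp only [mem_image, Prod.exists, mem_symmDiff, mem_ofPred_eq]
    constructor
    · rintro ⟨ξ, hξ⟩
      exact ⟨A, B, ξ, by tauto, rfl⟩
    · rintro ⟨A', B', ξ, hξ, heq⟩
      obtain ⟨rfl, rfl⟩ := Prod.mk.inj heq
      exact ⟨ξ, by tauto⟩
  change MeasureTheory.AnalyticSet _
  rw [h]
  exact (h1.symmDiff h2).analyticSet.image_of_continuous continuous_fst

end SA

theorem mainTheorem9 (H : Type*) [NormedAddCommGroup H] [InnerProductSpace ℂ H]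
    [CompleteSpace H] [TopologicalSpace.SeparableSpace H] :
    PolishSpace (SA H) ∧
      MeasurableSet[borel (SA H × H)] {p : SA H × H | p.2 ∈ p.1.dom} ∧
      (SA.domEquiv H).IsCoanalytic :=
  ⟨SA.polishSpace, SA.measurableSet_mem_dom, SA.isCoanalytic_domEquiv⟩
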